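/- Let $G=(V,E)$ be an infinite, locally finite, connected graph without loops or multiple edges, and let $\Delta f(x)=\sum_{y\sim x}\big(f(x)-f(y)\big)$ be its Laplacian. For a finite set $D$ of vertices let $\operatorname{int} D$ be the set of vertices of $D$ all of whose neighbours lie in $D$. Fix a vertex $o$, let $B_r$ be the set of vertices at graph distance at most $r$ from $o$, let $\Delta_r$ be the reduced Laplacian, acting on the functions $f$ that vanish outside $\operatorname{int} B_r$ by $\Delta_r f=\Delta f$ on $\operatorname{int} B_r$ and $\Delta_r f=0$ elsewhere, and let $p^r_t(x,y)=e^{-t\Delta_r}\delta_x(y)$ for $x,y\in \operatorname{int} B_r$ and $p^r_t(x,y)=0$ otherwise. The heat kernel of $G$ is $p_t(x,y)=\lim_{r\to\infty}p^r_t(x,y)$ for $t\ge 0$ and $x,y\in V$; it does not depend on $o$. The graph $G$ is called stochastically incomplete if $\sum_{y\in V}p_t(x,y)<1$ for some vertex $x$ and some $t>0$. Fix a vertex $x_0$. Let $S_r(x_0)$ be the set of vertices at distance exactly $r$ from $x_0$, and for $x\in S_r(x_0)$ let $m_{\pm1}(x)$ be the number of neighbours of $x$ in $S_{r\pm1}(x_0)$.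 Put $$\underline m_{+1}(r)=\min_{x\in S_r(x_0)}m_{+1}(x),\qquad \overline m_{-1}(r)=\max_{x\in S_r(x_0)}m_{-1}(x).$$ **Theorem.** If, for some vertex $x_0$ of $G$, $$\sum_{r=1}^\infty\frac{\overline m_{-1}(r)}{\underline m_{+1}(r)}<\infty$$ (where a term with $\underline m_{+1}(r)=0$ counts as $\infty$), then $G$ is stochastically incomplete. -/

import Mathlib

open scoped ENNReal

namespace StochInc

variable {V : Type*}

/-- The sphere `S_r(o)`: the vertices at distance exactly `r` from `o`. -/
def sphere (G : SimpleGraph V) (o : V) (r : ℕ) : Set V :=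
  {x | G.edist o x = r}

/-- The ball `B_r(o)`: the vertices at distance at most `r` from `o`. -/
def closedBall (G : SimpleGraph V) (o : V) (r : ℕ) : Set V :=
  {x | G.edist o x ≤ r}

/-- The interior of a set `D` of vertices: those vertices of `D` all of whose neighbours
lie in `D`. -/
def vertexInterior (G : SimpleGraph V) (D : Set V) : Set V :=
  {x | x ∈ D ∧ ∀ y, G.Adj x y → y ∈ D}

theorem finite_closedBall (G : SimpleGraph V) [G.LocallyFinite] (o : V) (r : ℕ) :
    (closedBall G o r).Finite := by
  induction r with
  | zero =>
    refine (Set.finite_singleton o).subset fun x hx => ?_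
    have h : G.edist o x = 0 := by
      simpa only [closedBall, Set.mem_ofPred_eq, Nat.cast_zero, nonpos_iff_eq_zero] using hx
    exact (SimpleGraph.edist_eq_zero_iff.mp h).symm
  | succ n ih =>
    refine (ih.union (ih.biUnion fun w _ => (G.neighborFinset w).finite_toSet)).subset
      fun x hx => ?_
    have hx' : G.edist x o ≤ ((n + 1 : ℕ) : ℕ∞) := by
      rw [SimpleGraph.edist_comm]; exact hx
    obtain ⟨p, hp⟩ := SimpleGraph.exists_walk_of_edist_ne_top
      (ne_top_of_le_ne_top (ENat.natCast_ne_top _) hx')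
    rw [← hp] at hx'
    have hl : p.length ≤ n + 1 := by exact_mod_cast hx'
    cases p with
    | nil =>
      left
      simp [closedBall]
    | @cons _ w _ h q =>
      right
      have hq : q.length ≤ n := by simpa using hl
      have hw : w ∈ closedBall G o n := by
        have h1 : G.edist w o ≤ (q.length : ℕ∞) := SimpleGraph.edist_le q
        have h2 : (q.length : ℕ∞) ≤ (n : ℕ∞) := by exact_mod_cast hq
        have h3 := h1.trans h2
        rw [SimpleGraph.edist_comm] at h3
        exact h3
      refine Set.mem_biUnion hw ?_
      simpa using h.symm

section

variable (G : SimpleGraph V) [G.LocallyFinite]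

/-- The Laplacian `Δ f(x) = ∑_{y ∼ x} (f(x) - f(y))`. -/
def laplacian (f : V → ℝ) (x : V) : ℝ :=
  ∑ y ∈ G.neighborFinset x, (f x - f y)

/-- The interior of the ball `B_r(o)`. -/
abbrev ballInterior (o : V) (r : ℕ) : Set V :=
  vertexInterior G (closedBall G o r)

noncomputable instance fintypeBallInterior (o : V) (r : ℕ) : Fintype (ballInterior G o r) :=
  ((finite_closedBall G o r).subset fun _ hx => hx.1).fintype

open Classical in
/-- The matrix of the reduced (Dirichlet) Laplacian `Δ_r`, acting on the functions that vanish
outside the interior of `B_r(o)`: its entry at `(y, x)` is `Δ δ_x (y)`. -/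
noncomputable def reducedLaplacian (o : V) (r : ℕ) :
    Matrix (ballInterior G o r) (ballInterior G o r) ℝ :=
  Matrix.of fun y x => laplacian G (Pi.single (x : V) 1) y

open Classical in
/-- The Dirichlet heat kernel `p_t^r(x, y) = e^{-t Δ_r} δ_x (y)` of the ball `B_r(o)`, extended
by `0` when `x` or `y` is not in the interior of `B_r(o)`. -/
noncomputable def dirichletHeatKernel (o : V) (r : ℕ) (t : ℝ) (x y : V) : ℝ :=
  if h : x ∈ ballInterior G o r ∧ y ∈ ballInterior G o r then
    NormedSpace.exp ((-t) • reducedLaplacian G o r) ⟨y, h.2⟩ ⟨x, h.1⟩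
  else 0

/-- The heat kernel `p_t(x, y) = lim_{r → ∞} p_t^r(x, y)`, built from the exhaustion of the graph
by the balls about `o`. -/
noncomputable def heatKernel (o : V) (t : ℝ) (x y : V) : ℝ :=
  Filter.limUnder Filter.atTop fun r : ℕ => dirichletHeatKernel G o r t x y

/-- `G` is stochastically incomplete: `∑_y p_t(x, y) < 1` for some vertex `x` and some `t > 0`.
The heat kernel of a connected graph does not depend on the centre `o` of the exhaustion;
the property is required for every choice of it. -/
def StochasticallyIncomplete : Prop :=
  ∀ o : V, ∃ x : V, ∃ t : ℝ, 0 < t ∧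
    Summable (fun y => heatKernel G o t x y) ∧ ∑' y, heatKernel G o t x y < 1

/-- `m_{+1}(x)`: the number of neighbours of `x` that are one step further from `o` than `x`. -/
noncomputable def forwardDegree (o x : V) : ℕ :=
  ((G.neighborFinset x).filter fun y => G.edist o y = G.edist o x + 1).card

/-- `m_{-1}(x)`: the number of neighbours of `x` that are one step closer to `o` than `x`. -/
noncomputable def backwardDegree (o x : V) : ℕ :=
  ((G.neighborFinset x).filter fun y => G.edist o y + 1 = G.edist o x).card

/-- The minimum of `m_{+1}` over the sphere `S_r(o)`, as an extended non-negative real. -/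
noncomputable def minForward (o : V) (r : ℕ) : ℝ≥0∞ :=
  ⨅ x ∈ sphere G o r, (forwardDegree G o x : ℝ≥0∞)

/-- The maximum of `m_{-1}` over the sphere `S_r(o)`, as an extended non-negative real. -/
noncomputable def maxBackward (o : V) (r : ℕ) : ℝ≥0∞ :=
  ⨆ x ∈ sphere G o r, (backwardDegree G o x : ℝ≥0∞)

end

end StochInc

/-! A bounded `v ≥ 1` with `Δ v ≤ -v` forces loss of heat: for suitable `k` and `T`, `h(s, x) = 1 +
kC - k e^s v(x)` with `C` an upper bound for `v` is a nonnegative supersolution of the heat equation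
on `[0, T]`, starts at or above `1` and ends below `1`. By comparison it bounds the mass of every
Dirichlet kernel, hence of their increasing limit (`stochasticallyIncomplete_of_laplacian_le_neg`).

Such a `v` is radial: `v = g(dist x₀ ·)` with `g(r + 1) = g(r) (1 + 2 a r)`, where `a r` is the
quotient in the series for `r ≥ 1`. Summability of `a` bounds the product, and `m_{-1} ≤ a m_{+1}`
together with `1 ≤ a m_{+1}` gives `Δ v ≤ -v` through `laplacian_radial`. -/

/-! ### Exponentials of matrices that are nonnegative off the diagonal. -/

section Metzler

variable {n : Type*} [Fintype n] [DecidableEq n]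

/-- The exponential of a matrix with nonnegative entries has nonnegative entries. -/
theorem Matrix.exp_apply_nonneg {A : Matrix n n ℝ} (hA : ∀ i j, 0 ≤ A i j) (i j : n) :
    0 ≤ NormedSpace.exp A i j := by
  have hpow : ∀ k i j, 0 ≤ (A ^ k) i j := by
    intro k
    induction k with
    | zero => intro i j; rw [pow_zero, Matrix.one_apply]; split_ifs <;> norm_num
    | succ k ih =>
      intro i j
      rw [pow_succ, Matrix.mul_apply]
      exact Finset.sum_nonneg fun l _ => mul_nonneg (ih i l) (hA l j)
  open scoped Matrix.Norms.Operator in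
  have h := NormedSpace.exp_series_hasSum_exp' (𝕂 := ℝ) A
  have h' : HasSum (fun k : ℕ => ((k.factorial : ℝ)⁻¹ • A ^ k) i j) (NormedSpace.exp A i j) :=
    Pi.hasSum.mp (Pi.hasSum.mp h i) j
  exact h'.nonneg fun k => mul_nonneg (by positivity) (hpow k i j)

/-- The exponential of a matrix with nonnegative off-diagonal entries has nonnegative entries. -/
theorem Matrix.exp_apply_nonneg_of_offDiag {A : Matrix n n ℝ}
    (hA : ∀ i j, i ≠ j → 0 ≤ A i j) (i j : n) : 0 ≤ NormedSpace.exp A i j := by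
  -- Adding `c` to the diagonal makes every entry nonnegative; the shift is scalar, so it commutes
  -- and only contributes the factor `e^{-c}`.
  set c : ℝ := ∑ i, |A i i| with hc
  have hsplit : A = Matrix.diagonal (fun _ => -c) + (A + Matrix.diagonal (fun _ => c)) := by
    ext a b
    by_cases hab : a = b <;> simp [hab]
  have hcomm : Commute (Matrix.diagonal (fun _ : n => -c)) (A + Matrix.diagonal (fun _ => c)) := by
    have : Matrix.diagonal (fun _ : n => -c) = algebraMap ℝ (Matrix n n ℝ) (-c) := rfl
    rw [this]
    exact Algebra.commutes _ _
  have hB : ∀ a b, 0 ≤ (A + Matrix.diagonal (fun _ : n => c)) a b := by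
    intro a b
    by_cases hab : a = b
    · subst hab
      have h1 : |A a a| ≤ c := Finset.single_le_sum (f := fun i => |A i i|)
        (fun i _ => abs_nonneg _) (Finset.mem_univ a)
      have h2 := neg_abs_le (A a a)
      simp only [Matrix.add_apply, Matrix.diagonal_apply_eq]
      linarith
    · simpa [hab] using hA a b hab
  rw [hsplit, Matrix.exp_add_of_commute _ _ hcomm, Matrix.exp_diagonal, Matrix.diagonal_mul]
  refine mul_nonneg ?_ (Matrix.exp_apply_nonneg hB i j)
  rw [Pi.coe_exp, ← Real.exp_eq_exp_ℝ]
  positivity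

theorem Matrix.hasDerivAt_exp_smul_apply (A : Matrix n n ℝ) (t : ℝ) (i j : n) :
    HasDerivAt (fun s : ℝ => NormedSpace.exp (s • A) i j)
      ((NormedSpace.exp (t • A) * A) i j) t := by
  open scoped Matrix.Norms.Operator in
  have h := hasDerivAt_exp_smul_const (𝕂 := ℝ) A t
  exact hasDerivAt_pi.mp (hasDerivAt_pi.mp h i) j

theorem Matrix.hasDerivAt_exp_smul_apply' (A : Matrix n n ℝ) (t : ℝ) (i j : n) :
    HasDerivAt (fun s : ℝ => NormedSpace.exp (s • A) i j)
      ((A * NormedSpace.exp (t • A)) i j) t := by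
  open scoped Matrix.Norms.Operator in
  have h := hasDerivAt_exp_smul_const' (𝕂 := ℝ) A t
  exact hasDerivAt_pi.mp (hasDerivAt_pi.mp h i) j

/-- Comparison principle for the linear system `h' = A h` with `A` nonnegative off the diagonal:
a supersolution dominates the solution with the same initial value. -/
theorem Matrix.exp_mulVec_le_of_supersolution {A : Matrix n n ℝ}
    (hA : ∀ i j, i ≠ j → 0 ≤ A i j) {t : ℝ} (ht : 0 ≤ t) {h h' : ℝ → n → ℝ}
    (hd : ∀ s j, HasDerivAt (fun s => h s j) (h' s j) s)
    (hsup : ∀ s, 0 ≤ s → s ≤ t → ∀ j, (A.mulVec (h s)) j ≤ h' s j) (i : n) :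
    ((NormedSpace.exp (t • A)).mulVec (h 0)) i ≤ h t i := by
  -- Duhamel interpolation: `e^{(t-s)A} h(s)` runs from `e^{tA} h(0)` to `h(t)`, and its derivative
  -- `e^{(t-s)A} (h' - A h)` is nonnegative.
  have hder : ∀ s, HasDerivAt (fun s => ∑ j, NormedSpace.exp ((t - s) • A) i j * h s j)
      (∑ j, NormedSpace.exp ((t - s) • A) i j * (h' s j - (A.mulVec (h s)) j)) s := by
    intro s
    have hE : ∀ j, HasDerivAt (fun s => NormedSpace.exp ((t - s) • A) i j)
        (-(NormedSpace.exp ((t - s) • A) * A) i j) s := by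
      intro j
      have h1 := (Matrix.hasDerivAt_exp_smul_apply A (t - s) i j).comp s
        ((hasDerivAt_id s).const_sub t)
      simpa using! h1
    have h2 := HasDerivAt.fun_sum (u := Finset.univ) fun j _ => (hE j).mul (hd s j)
    refine h2.congr_deriv ?_
    have h3 : ∑ j, (NormedSpace.exp ((t - s) • A) * A) i j * h s j
        = ∑ j, NormedSpace.exp ((t - s) • A) i j * (A.mulVec (h s)) j := by
      have := congrFun (Matrix.mulVec_mulVec (h s) (NormedSpace.exp ((t - s) • A)) A) i
      simpa [Matrix.mulVec, dotProduct] using this.symm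
    simp only [mul_sub, neg_mul, Finset.sum_add_distrib, Finset.sum_sub_distrib,
      Finset.sum_neg_distrib, h3]
    ring
  have hmono : MonotoneOn (fun s => ∑ j, NormedSpace.exp ((t - s) • A) i j * h s j)
      (Set.Icc 0 t) := by
    refine monotoneOn_of_deriv_nonneg (convex_Icc 0 t)
      (fun s _ => (hder s).continuousAt.continuousWithinAt)
      (fun s _ => (hder s).differentiableAt.differentiableWithinAt) fun s hs => ?_
    rw [interior_Icc] at hs
    rw [(hder s).deriv]
    refine Finset.sum_nonneg fun j _ => mul_nonneg ?_ (sub_nonneg.mpr (hsup s hs.1.le hs.2.le j))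
    exact Matrix.exp_apply_nonneg_of_offDiag
      (fun a b hab => mul_nonneg (by linarith [hs.2]) (hA a b hab)) i j
  have := hmono (Set.left_mem_Icc.mpr ht) (Set.right_mem_Icc.mpr ht) ht
  simpa [Matrix.mulVec, dotProduct, Matrix.one_apply] using this

end Metzler

/-! ### Dirichlet heat kernels: comparison, monotone limit and the criterion for incompleteness. -/

namespace StochInc

theorem ballInterior_mono {V : Type*} (G : SimpleGraph V) (o : V) {r r' : ℕ} (hr : r ≤ r') :
    ballInterior G o r ⊆ ballInterior G o r' := by
  have hb : closedBall G o r ⊆ closedBall G o r' := fun x hx =>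
    le_trans (show G.edist o x ≤ r from hx) (by exact_mod_cast hr)
  exact fun x hx => ⟨hb hx.1, fun y hy => hb (hx.2 y hy)⟩

variable {V : Type*} (G : SimpleGraph V) [G.LocallyFinite]

/-- The Dirichlet Laplacian is the Laplacian of the extension by zero. -/
theorem reducedLaplacian_mulVec (o : V) (r : ℕ) (f : V → ℝ) (y : ballInterior G o r) :
    ((reducedLaplacian G o r).mulVec fun x => f x) y
      = laplacian G ((ballInterior G o r).indicator f) y := by
  classical
  have hval : ∀ z : V, ∑ x : ballInterior G o r, (Pi.single (x : V) (1 : ℝ) : V → ℝ) z * f x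
      = if z ∈ ballInterior G o r then f z else 0 := by
    intro z
    split_ifs with hz
    · rw [Finset.sum_eq_single (⟨z, hz⟩ : ballInterior G o r)]
      · simp
      · intro b _ hb
        rw [Pi.single_eq_of_ne, zero_mul]
        exact fun h => hb (Subtype.ext h.symm)
      · simp
    · refine Finset.sum_eq_zero fun b _ => ?_
      rw [Pi.single_eq_of_ne, zero_mul]
      exact fun h => hz (h ▸ b.2)
  simp only [Matrix.mulVec, dotProduct, reducedLaplacian, Matrix.of_apply, laplacian,
    Finset.sum_mul]
  rw [Finset.sum_comm]
  refine Finset.sum_congr rfl fun z _ => ?_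
  simp only [sub_mul, Finset.sum_sub_distrib, hval, Set.indicator_apply]

/-- The Dirichlet Laplacian of a nonnegative function dominates its Laplacian: restricting the
function to the interior only removes nonnegative neighbouring values. -/
theorem laplacian_le_reducedLaplacian_mulVec (o : V) (r : ℕ) {f : V → ℝ} (hf : ∀ x, 0 ≤ f x)
    (y : ballInterior G o r) :
    laplacian G f y ≤ ((reducedLaplacian G o r).mulVec fun x => f x) y := by
  rw [reducedLaplacian_mulVec, laplacian, laplacian, Set.indicator_of_mem y.2]
  exact Finset.sum_le_sum fun z _ =>
    sub_le_sub_left (Set.indicator_le_self' (fun x _ => hf x) z) _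

theorem reducedLaplacian_nonpos_of_ne (o : V) (r : ℕ) (i j : ballInterior G o r) (hij : i ≠ j) :
    reducedLaplacian G o r i j ≤ 0 := by
  classical
  simp only [reducedLaplacian, Matrix.of_apply, laplacian]
  refine Finset.sum_nonpos fun z _ => ?_
  rw [Pi.single_eq_of_ne (fun h => hij (Subtype.ext h)), zero_sub, neg_nonpos, Pi.single_apply]
  split_ifs <;> norm_num

theorem reducedLaplacian_isSymm (o : V) (r : ℕ) : (reducedLaplacian G o r).IsSymm := by
  classical
  refine Matrix.IsSymm.ext fun i j => ?_
  by_cases hij : i = j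
  · rw [hij]
  have hij' : (i : V) ≠ j := fun h => hij (Subtype.ext h)
  have key : ∀ a b : V, a ≠ b →
      laplacian G (Pi.single a (1 : ℝ)) b = -(if G.Adj b a then 1 else 0) := by
    intro a b hab
    simp only [laplacian, Pi.single_eq_of_ne hab.symm, zero_sub, Finset.sum_neg_distrib,
      Pi.single_apply, Finset.sum_ite_eq', SimpleGraph.mem_neighborFinset]
  simp only [reducedLaplacian, Matrix.of_apply]
  have h1 := key i j hij'
  have h2 := key j i hij'.symm
  simp only [G.adj_comm] at h1 h2 ⊢
  convert h1.trans _ using 1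
  rw [h2]

open Classical in
/-- A nonnegative supersolution of the heat equation in the interior of a ball dominates the
Dirichlet heat semigroup applied to its initial value. -/
theorem exp_reducedLaplacian_mulVec_le (o : V) (r : ℕ) {t : ℝ} (ht : 0 ≤ t)
    {h h' : ℝ → V → ℝ} (hd : ∀ s x, HasDerivAt (fun s => h s x) (h' s x) s)
    (hnn : ∀ s, 0 ≤ s → s ≤ t → ∀ x, 0 ≤ h s x)
    (hsup : ∀ s, 0 ≤ s → s ≤ t → ∀ x ∈ ballInterior G o r, -laplacian G (h s) x ≤ h' s x)
    (x : ballInterior G o r) :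
    ((NormedSpace.exp ((-t) • reducedLaplacian G o r)).mulVec fun y => h 0 y) x ≤ h t x := by
  have key := Matrix.exp_mulVec_le_of_supersolution (A := -reducedLaplacian G o r)
    (fun i j hij => by simpa using reducedLaplacian_nonpos_of_ne G o r i j hij) ht
    (h := fun s y => h s y) (h' := fun s y => h' s y) (fun s j => hd s j)
    (fun s hs0 hst j => by
      rw [Matrix.neg_mulVec, Pi.neg_apply]
      exact (neg_le_neg (laplacian_le_reducedLaplacian_mulVec G o r (hnn s hs0 hst) j)).trans
        (hsup s hs0 hst j j.2)) x
  rwa [smul_neg, ← neg_smul] at key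

theorem dirichletHeatKernel_nonneg (o : V) (r : ℕ) {t : ℝ} (ht : 0 ≤ t) (x y : V) :
    0 ≤ dirichletHeatKernel G o r t x y := by
  classical
  rw [dirichletHeatKernel]
  split_ifs with h
  · refine Matrix.exp_apply_nonneg_of_offDiag (fun i j hij => ?_) _ _
    have := reducedLaplacian_nonpos_of_ne G o r i j hij
    simp only [Matrix.smul_apply, smul_eq_mul]
    nlinarith
  · exact le_rfl

/-- Derivative in time of the Dirichlet heat kernel, in the form of a differential
inequality. -/
theorem exists_hasDerivAt_dirichletHeatKernel (o : V) (r : ℕ) (x : V) :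
    ∃ h' : ℝ → V → ℝ,
      (∀ s y, HasDerivAt (fun s => dirichletHeatKernel G o r s x y) (h' s y) s) ∧
      ∀ s, ∀ y ∈ ballInterior G o r,
        -laplacian G (dirichletHeatKernel G o r s x) y ≤ h' s y := by
  classical
  by_cases hx : x ∈ ballInterior G o r
  · refine ⟨fun s y => if hy : y ∈ ballInterior G o r then
      -((reducedLaplacian G o r * NormedSpace.exp ((-s) • reducedLaplacian G o r))
        ⟨y, hy⟩ ⟨x, hx⟩) else 0, fun s y => ?_, fun s y hy => ?_⟩
    · by_cases hy : y ∈ ballInterior G o r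
      · simp only [dirichletHeatKernel, hx, hy, and_self, dif_pos]
        have h1 := (Matrix.hasDerivAt_exp_smul_apply' (reducedLaplacian G o r) (-s)
          ⟨y, hy⟩ ⟨x, hx⟩).comp s (hasDerivAt_neg s)
        exact h1.congr_deriv (mul_neg_one _)
      · simp only [dirichletHeatKernel, hy, and_false, dif_neg, not_false_eq_true]
        exact hasDerivAt_const s 0
    · simp only [dif_pos hy]
      -- The kernel already vanishes off the interior, so extension by zero changes nothing and the
      -- inequality is in fact an equality.
      have hind : (ballInterior G o r).indicator (dirichletHeatKernel G o r s x)
          = dirichletHeatKernel G o r s x :=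
        Set.indicator_eq_self.mpr fun z hz => by
          by_contra hz'
          exact hz (by rw [dirichletHeatKernel, dif_neg fun e => hz' e.2])
      have hlap := reducedLaplacian_mulVec G o r (dirichletHeatKernel G o r s x) ⟨y, hy⟩
      rw [hind] at hlap
      rw [← hlap]
      refine neg_le_neg (le_of_eq ?_)
      rw [Matrix.mul_apply, Matrix.mulVec, dotProduct]
      refine Finset.sum_congr rfl fun z _ => ?_
      rw [dirichletHeatKernel, dif_pos ⟨hx, z.2⟩]
  · refine ⟨0, fun s y => ?_, fun s y hy => ?_⟩
    · simpa [dirichletHeatKernel, hx] using! hasDerivAt_const s (0 : ℝ)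
    · simp [laplacian, dirichletHeatKernel, hx]

theorem dirichletHeatKernel_zero (o : V) (r : ℕ) (x y : V) [Decidable (x = y)]
    (hx : x ∈ ballInterior G o r) (hy : y ∈ ballInterior G o r) :
    dirichletHeatKernel G o r 0 x y = if x = y then 1 else 0 := by
  classical
  rw [dirichletHeatKernel, dif_pos ⟨hx, hy⟩, neg_zero, zero_smul, NormedSpace.exp_zero,
    Matrix.one_apply]
  simp only [Subtype.mk.injEq, eq_comm]

/-- Domain monotonicity of the Dirichlet heat kernels. -/
theorem dirichletHeatKernel_mono (o : V) {t : ℝ} (ht : 0 ≤ t) (x y : V) :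
    Monotone fun r => dirichletHeatKernel G o r t x y := by
  classical
  intro r r' hr
  show dirichletHeatKernel G o r t x y ≤ dirichletHeatKernel G o r' t x y
  by_cases h : x ∈ ballInterior G o r ∧ y ∈ ballInterior G o r
  -- The kernel of the larger ball is a nonnegative supersolution on the smaller one, with initial
  -- value `δ_x` there.
  · obtain ⟨h', hd, hsup⟩ := exists_hasDerivAt_dirichletHeatKernel G o r' x
    have hsub := ballInterior_mono G o hr
    have key := exp_reducedLaplacian_mulVec_le G o r ht hd
      (fun s hs _ => dirichletHeatKernel_nonneg G o r' hs x)
      (fun s _ _ z hz => hsup s z (hsub hz)) ⟨y, h.2⟩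
    refine le_trans (le_of_eq ?_) key
    rw [dirichletHeatKernel, dif_pos h, Matrix.mulVec, dotProduct,
      Finset.sum_eq_single (⟨x, h.1⟩ : ballInterior G o r)]
    · rw [dirichletHeatKernel_zero G o r' x x (hsub h.1) (hsub h.1), if_pos rfl, mul_one]
    · intro b _ hb
      rw [dirichletHeatKernel_zero G o r' x b (hsub h.1) (hsub b.2),
        if_neg fun e => hb (Subtype.ext e.symm), mul_zero]
    · simp
  · rw [dirichletHeatKernel, dif_neg h]
    exact dirichletHeatKernel_nonneg G o r' ht x y

/-- A nonnegative supersolution of the heat equation with initial value at least `1` bounds the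
total mass of the Dirichlet heat kernels. -/
theorem sum_dirichletHeatKernel_le (o : V) (r : ℕ) {t : ℝ} (ht : 0 ≤ t)
    {h h' : ℝ → V → ℝ} (hd : ∀ s x, HasDerivAt (fun s => h s x) (h' s x) s)
    (hnn : ∀ s, 0 ≤ s → s ≤ t → ∀ x, 0 ≤ h s x)
    (hsup : ∀ s, 0 ≤ s → s ≤ t → ∀ x, -laplacian G (h s) x ≤ h' s x)
    (h0 : ∀ x, 1 ≤ h 0 x) (x : V) (F : Finset V) :
    ∑ y ∈ F, dirichletHeatKernel G o r t x y ≤ h t x := by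
  classical
  by_cases hx : x ∈ ballInterior G o r
  · refine le_trans ?_ (exp_reducedLaplacian_mulVec_le G o r ht hd hnn
      (fun s hs hst z _ => hsup s hs hst z) ⟨x, hx⟩)
    -- The comparison bounds sums along row `x`, whereas the kernel from `x` is column `x`.
    have hsymm : ∀ i j, NormedSpace.exp ((-t) • reducedLaplacian G o r) i j
        = NormedSpace.exp ((-t) • reducedLaplacian G o r) j i := fun i j =>
      (((reducedLaplacian_isSymm G o r).smul (-t)).exp).apply j i
    have hker : ∀ y : ballInterior G o r, dirichletHeatKernel G o r t x y
        = NormedSpace.exp ((-t) • reducedLaplacian G o r) ⟨x, hx⟩ y := fun y => by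
      rw [dirichletHeatKernel, dif_pos ⟨hx, y.2⟩, hsymm]
    calc ∑ y ∈ F, dirichletHeatKernel G o r t x y
        ≤ ∑ y ∈ F ∪ (ballInterior G o r).toFinset, dirichletHeatKernel G o r t x y :=
          Finset.sum_le_sum_of_subset_of_nonneg Finset.subset_union_left
            fun y _ _ => dirichletHeatKernel_nonneg G o r ht x y
      _ = ∑ y ∈ (ballInterior G o r).toFinset, dirichletHeatKernel G o r t x y := by
          refine (Finset.sum_subset Finset.subset_union_right fun y _ hy => ?_).symm
          rw [dirichletHeatKernel, dif_neg fun e => hy (Set.mem_toFinset.mpr e.2)]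
      _ = ∑ y : ballInterior G o r, dirichletHeatKernel G o r t x y :=
          Finset.sum_subtype _ (fun _ => Set.mem_toFinset) _
      _ ≤ _ := by
          rw [Matrix.mulVec, dotProduct]
          refine Finset.sum_le_sum fun y _ => ?_
          rw [hker]
          exact le_mul_of_one_le_right (hker y ▸ dirichletHeatKernel_nonneg G o r ht x y) (h0 y)
  · refine le_trans (le_of_eq (Finset.sum_eq_zero fun y _ => ?_)) (hnn t ht le_rfl x)
    rw [dirichletHeatKernel, dif_neg fun e => hx e.1]

/-- A uniform bound for the masses of the Dirichlet heat kernels passes to the heat kernel. -/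
theorem summable_heatKernel_and_tsum_le (o : V) {t : ℝ} (ht : 0 ≤ t) (x : V) {b : ℝ}
    (hb : ∀ (r : ℕ) (F : Finset V), ∑ y ∈ F, dirichletHeatKernel G o r t x y ≤ b) :
    Summable (fun y => heatKernel G o t x y) ∧ ∑' y, heatKernel G o t x y ≤ b := by
  -- Monotone and bounded by `b`, so `limUnder` is a genuine limit and not a default value.
  have hlim : ∀ y, Filter.Tendsto (fun r => dirichletHeatKernel G o r t x y) Filter.atTop
      (nhds (heatKernel G o t x y)) := fun y =>
    tendsto_nhds_limUnder ⟨_, tendsto_atTop_ciSup (dirichletHeatKernel_mono G o ht x y)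
      ⟨b, by rintro _ ⟨r, rfl⟩; simpa using hb r {y}⟩⟩
  have hnn : ∀ y, 0 ≤ heatKernel G o t x y := fun y =>
    ge_of_tendsto' (hlim y) fun r => dirichletHeatKernel_nonneg G o r ht x y
  have hF : ∀ F : Finset V, ∑ y ∈ F, heatKernel G o t x y ≤ b := fun F =>
    le_of_tendsto' (tendsto_finsetSum F fun y _ => hlim y) fun r => hb r F
  exact ⟨summable_of_sum_le hnn hF, Real.tsum_le_of_sum_le hnn hF⟩

/-- A graph carrying a bounded function `v ≥ 1` with `Δ v ≤ -v` is stochastically incomplete. -/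
theorem stochasticallyIncomplete_of_laplacian_le_neg {v : V → ℝ} {C : ℝ}
    (hv1 : ∀ x, 1 ≤ v x) (hvC : ∀ x, v x ≤ C) (hv : ∀ x, laplacian G v x ≤ -v x) :
    StochasticallyIncomplete G := by
  intro o
  have hC : 1 ≤ C := (hv1 o).trans (hvC o)
  have hC0 : 0 < C := by linarith
  -- With `e^T = C + 1` and `k = C⁻²`, nonnegativity up to `T` is the identity `k (C + 1) C = 1 +
  -- kC`, and `v ≥ 1` gives the final value at most `1 - k`.
  set T := Real.log (C + 1)
  have hT0 : 0 < T := Real.log_pos (by linarith)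
  have heT : Real.exp T = C + 1 := Real.exp_log (by linarith)
  set k : ℝ := (C ^ 2)⁻¹ with hk
  have hk0 : 0 < k := by positivity
  have hkC : k * C * C = 1 := by rw [hk]; field_simp
  have hlap : ∀ s x, laplacian G (fun x => 1 + k * C - k * Real.exp s * v x) x
      = -(k * Real.exp s) * laplacian G v x := by
    intro s x
    simp only [laplacian, Finset.mul_sum]
    refine Finset.sum_congr rfl fun z _ => ?_
    ring
  have hbound := fun r F => sum_dirichletHeatKernel_le G o r hT0.le
    (h := fun s x => 1 + k * C - k * Real.exp s * v x)
    (h' := fun s x => -(k * Real.exp s * v x))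
    (fun s x => by
      simpa using! (((Real.hasDerivAt_exp s).const_mul k).mul_const (v x)).const_sub (1 + k * C))
    (fun s _ hs x => by
      have h1 : Real.exp s ≤ C + 1 := heT ▸ Real.exp_le_exp.mpr hs
      have h2 : k * Real.exp s * v x ≤ k * (C + 1) * C := by
        have := hvC x
        have := hv1 x
        gcongr
      have h3 : k * (C + 1) * C = 1 + k * C := by linear_combination hkC
      linarith)
    (fun s _ _ x => by
      rw [hlap]
      have := mul_le_mul_of_nonneg_left (hv x) (mul_pos hk0 (Real.exp_pos s)).le
      linarith)
    (fun x => by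
      have := mul_le_mul_of_nonneg_left (hvC x) hk0.le
      simp only [Real.exp_zero, mul_one]
      linarith) o F
  obtain ⟨hs, hle⟩ := summable_heatKernel_and_tsum_le G o hT0.le o hbound
  refine ⟨o, T, hT0, hs, hle.trans_lt ?_⟩
  rw [heT]
  have h1 := mul_le_mul_of_nonneg_left (hv1 o) (mul_pos hk0 (by linarith : 0 < C + 1)).le
  nlinarith

end StochInc

/-! ### Forward and backward degrees, and radial functions. -/

namespace StochInc

theorem mem_sphere_dist {V : Type*} {G : SimpleGraph V} (hG : G.Connected) (o x : V) : x ∈ sphere G o (G.dist o x) :=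
  ((hG o x).coe_dist_eq_edist).symm

variable {V : Type*} (G : SimpleGraph V) [G.LocallyFinite]

theorem forwardDegree_eq (hG : G.Connected) (o x : V) :
    forwardDegree G o x
      = ((G.neighborFinset x).filter fun y => G.dist o y = G.dist o x + 1).card := by
  rw [forwardDegree]
  congr 1
  ext y
  rw [Finset.mem_filter, Finset.mem_filter, ← (hG o y).coe_dist_eq_edist,
    ← (hG o x).coe_dist_eq_edist]
  norm_cast

theorem backwardDegree_eq (hG : G.Connected) (o x : V) :
    backwardDegree G o x
      = ((G.neighborFinset x).filter fun y => G.dist o y + 1 = G.dist o x).card := by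
  rw [backwardDegree]
  congr 1
  ext y
  rw [Finset.mem_filter, Finset.mem_filter, ← (hG o y).coe_dist_eq_edist,
    ← (hG o x).coe_dist_eq_edist]
  norm_cast

/-- The first step of a geodesic from `x` to `o` is a backward neighbour. -/
theorem backwardDegree_pos (hG : G.Connected) {o x : V} (hx : o ≠ x) :
    0 < backwardDegree G o x := by
  rw [backwardDegree_eq G hG, Finset.card_pos]
  obtain ⟨p, hp⟩ := hG.exists_walk_length_eq_dist x o
  cases p with
  | nil => exact absurd rfl hx
  | @cons _ w _ h q =>
    refine ⟨w, Finset.mem_filter.mpr ⟨(G.mem_neighborFinset x w).mpr h, ?_⟩⟩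
    have h1 : G.dist w o ≤ q.length := SimpleGraph.dist_le q
    have h2 : G.dist x o ≤ G.dist x w + G.dist w o := hG.dist_triangle
    rw [SimpleGraph.dist_eq_one_iff_adj.mpr h] at h2
    rw [SimpleGraph.Walk.length_cons] at hp
    rw [G.dist_comm (u := o) (v := w), G.dist_comm (u := o) (v := x)]
    omega

theorem backwardDegree_self (o : V) : backwardDegree G o o = 0 := by
  simp [backwardDegree]

theorem forwardDegree_self_pos [Infinite V] (hG : G.Connected) (o : V) :
    0 < forwardDegree G o o := by
  rw [forwardDegree_eq G hG, Finset.card_pos]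
  obtain ⟨w, hw⟩ := hG.preconnected.exists_adj_of_nontrivial o
  exact ⟨w, by simpa [SimpleGraph.dist_eq_one_iff_adj] using hw⟩

/-- The Laplacian of a radial function in terms of the numbers of neighbours one step further and
one step closer. -/
theorem laplacian_radial (hG : G.Connected) (o x : V) (g : ℕ → ℝ) :
    laplacian G (fun y => g (G.dist o y)) x
      = forwardDegree G o x * (g (G.dist o x) - g (G.dist o x + 1))
        + backwardDegree G o x * (g (G.dist o x) - g (G.dist o x - 1)) := by
  rw [forwardDegree_eq G hG, backwardDegree_eq G hG, ← nsmul_eq_mul, ← nsmul_eq_mul,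
    ← Finset.sum_const, ← Finset.sum_const, Finset.sum_filter, Finset.sum_filter,
    ← Finset.sum_add_distrib, laplacian]
  refine Finset.sum_congr rfl fun y hy => ?_
  have hadj : G.Adj x y := (G.mem_neighborFinset x y).mp hy
  have h1 : G.dist o y ≤ G.dist o x + G.dist x y := hG.dist_triangle
  have h2 : G.dist o x ≤ G.dist o y + G.dist y x := hG.dist_triangle
  rw [SimpleGraph.dist_eq_one_iff_adj.mpr hadj] at h1
  rw [SimpleGraph.dist_eq_one_iff_adj.mpr hadj.symm] at h2
  -- Neighbours on the same sphere contribute zero. At `x = o` the truncated `0 - 1` is harmless, as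
  -- no neighbour is closer.
  rcases (by omega : G.dist o y = G.dist o x + 1 ∨ G.dist o y + 1 = G.dist o x ∨
    G.dist o y = G.dist o x) with h | h | h
  · rw [if_pos h, if_neg (by omega), h, add_zero]
  · rw [if_neg (by omega), if_pos h, zero_add, ← h, Nat.add_sub_cancel]
  · rw [if_neg (by omega), if_neg (by omega), h]
    simp

theorem backwardDegree_le_mul_forwardDegree (hG : G.Connected) {o x : V} (hx : o ≠ x)
    (hfin : maxBackward G o (G.dist o x) / minForward G o (G.dist o x) ≠ ∞) :
    (backwardDegree G o x : ℝ)
      ≤ (maxBackward G o (G.dist o x) / minForward G o (G.dist o x)).toReal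
        * forwardDegree G o x := by
  have hmem := mem_sphere_dist hG o x
  have hmax : (backwardDegree G o x : ℝ≥0∞) ≤ maxBackward G o (G.dist o x) :=
    le_iSup₂ (f := fun x (_ : x ∈ sphere G o (G.dist o _)) => (backwardDegree G o x : ℝ≥0∞)) x hmem
  have hmin : minForward G o (G.dist o x) ≤ (forwardDegree G o x : ℝ≥0∞) :=
    iInf₂_le (f := fun x (_ : x ∈ sphere G o (G.dist o _)) => (forwardDegree G o x : ℝ≥0∞)) x hmem
  -- A nonzero numerator excludes `0 / 0 = 0`, so a zero denominator would make the quotient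
  -- infinite.
  have hpos : maxBackward G o (G.dist o x) ≠ 0 := fun h => by
    rw [h, nonpos_iff_eq_zero] at hmax
    exact (backwardDegree_pos G hG hx).ne' (by exact_mod_cast hmax)
  have hm0 : minForward G o (G.dist o x) ≠ 0 := fun h => hfin (by
    rw [h]; exact ENNReal.div_zero hpos)
  have hmT : minForward G o (G.dist o x) ≠ ∞ := ne_top_of_le_ne_top (ENNReal.natCast_ne_top _) hmin
  have key : (backwardDegree G o x : ℝ≥0∞)
      ≤ maxBackward G o (G.dist o x) / minForward G o (G.dist o x) * forwardDegree G o x :=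
    calc (backwardDegree G o x : ℝ≥0∞) ≤ maxBackward G o (G.dist o x) := hmax
      _ = maxBackward G o (G.dist o x) / minForward G o (G.dist o x)
            * minForward G o (G.dist o x) := (ENNReal.div_mul_cancel hm0 hmT).symm
      _ ≤ _ := by gcongr
  have := ENNReal.toReal_mono (ENNReal.mul_ne_top hfin (ENNReal.natCast_ne_top _)) key
  simpa using this

end StochInc

/-! ### The bounded radial function. -/

/-- Let `G` be an infinite, locally finite, connected simple graph and `x₀` a vertex of it. If
`∑_{r ≥ 1} max_{S_r(x₀)} m_{-1} / min_{S_r(x₀)} m_{+1} < ∞`, where a quotient `a / 0` with `a > 0`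
is `∞`, then `G` is stochastically incomplete. -/
theorem mainTheorem2 {V : Type*} [Infinite V] (G : SimpleGraph V) [G.LocallyFinite]
    (hG : G.Connected) (x₀ : V)
    (hsum : ∑' r : ℕ, StochInc.maxBackward G x₀ (r + 1) / StochInc.minForward G x₀ (r + 1) < ∞) :
    StochInc.StochasticallyIncomplete G := by
  set q : ℕ → ℝ≥0∞ := fun r => StochInc.maxBackward G x₀ r / StochInc.minForward G x₀ r with hq
  -- At the root `m_{-1} = 0` and `m_{+1} ≥ 1`, so the value `1` makes both bounds in `hdeg` hold
  -- there too.
  set a : ℕ → ℝ := fun r => if r = 0 then 1 else (q r).toReal with ha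
  have ha0 : ∀ r, 0 ≤ a r := by
    intro r
    simp only [ha]
    split_ifs
    · exact zero_le_one
    · exact ENNReal.toReal_nonneg
  have hasum : Summable a := by
    rw [← summable_nat_add_iff 1]
    exact ENNReal.summable_toReal hsum.ne
  -- Of the factor `2`, one share of `a m_{+1} g` absorbs the backward term and the other leaves
  -- `-g`.
  set g : ℕ → ℝ := fun r => ∏ i ∈ Finset.range r, (1 + 2 * a i) with hg
  have hg_succ : ∀ r, g (r + 1) = g r * (1 + 2 * a r) := fun r => Finset.prod_range_succ _ _
  have hg1 : ∀ r, 1 ≤ g r := by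
    intro r
    induction r with
    | zero => simp [hg]
    | succ r ih =>
      rw [hg_succ]
      nlinarith [ha0 r]
  have hgC : ∀ r, g r ≤ Real.exp (∑' i, 2 * a i) := fun r =>
    (Real.prod_one_add_le_exp_sum _ fun i => mul_nonneg zero_le_two (ha0 i)).trans
      (Real.exp_le_exp.mpr ((hasum.mul_left 2).sum_le_tsum _
        fun i _ => mul_nonneg zero_le_two (ha0 i)))
  have hdeg : ∀ x, (StochInc.backwardDegree G x₀ x : ℝ)
        ≤ a (G.dist x₀ x) * StochInc.forwardDegree G x₀ x ∧
      1 ≤ a (G.dist x₀ x) * StochInc.forwardDegree G x₀ x := by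
    intro x
    by_cases hx : x₀ = x
    · subst hx
      have h1 : (1 : ℝ) ≤ StochInc.forwardDegree G x₀ x₀ := by
        exact_mod_cast StochInc.forwardDegree_self_pos G hG x₀
      simp only [ha, SimpleGraph.dist_self, if_true, one_mul, StochInc.backwardDegree_self,
        Nat.cast_zero]
      exact ⟨zero_le_one.trans h1, h1⟩
    · have hr : G.dist x₀ x ≠ 0 := fun h => hx (hG.dist_eq_zero_iff.mp h)
      have hfin : q (G.dist x₀ x) ≠ ∞ := by
        have := ENNReal.ne_top_of_tsum_ne_top hsum.ne (G.dist x₀ x - 1)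
        rwa [Nat.sub_add_cancel (Nat.one_le_iff_ne_zero.mpr hr)] at this
      have h1 := StochInc.backwardDegree_le_mul_forwardDegree G hG hx hfin
      have h2 : (1 : ℝ) ≤ StochInc.backwardDegree G x₀ x := by
        exact_mod_cast StochInc.backwardDegree_pos G hG hx
      simp only [ha, if_neg hr]
      exact ⟨h1, h2.trans h1⟩
  refine StochInc.stochasticallyIncomplete_of_laplacian_le_neg G
    (v := fun x => g (G.dist x₀ x)) (fun x => hg1 _) (fun x => hgC _) fun x => ?_
  rw [StochInc.laplacian_radial G hG, hg_succ]
  obtain ⟨h1, h2⟩ := hdeg x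
  set r := G.dist x₀ x
  have hgr := hg1 r
  -- Only `g (r - 1) ≥ 0` is needed, so this also covers `r = 0`.
  have h3 : (StochInc.backwardDegree G x₀ x : ℝ) * (g r - g (r - 1))
      ≤ StochInc.backwardDegree G x₀ x * g r :=
    mul_le_mul_of_nonneg_left (by linarith [hg1 (r - 1)]) (Nat.cast_nonneg _)
  have h4 := mul_le_mul_of_nonneg_right h1 (zero_le_one.trans hgr)
  have h5 := mul_le_mul_of_nonneg_right h2 (zero_le_one.trans hgr)
  linarith
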